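/- Let $G=\operatorname{Spec}\mathbb{R}[X,Y]\left[\frac{1}{X^2+Y^2}\right]$, so that $G(\mathbb{R})=\mathbb{R}^2\smallsetminus\{0\}$, and let $$E:\mathbb{R}^2\to G(\mathbb{R}),\qquad E(x,y)=\left(\operatorname{Re} e^{2\pi i(x+iy)},\ \operatorname{Im} e^{2\pi i(x+iy)}\right).$$ Call a subset $\mathcal{V}\subsetneq\mathbb{R}^2$ *weakly bialgebraic* if 1. there exist a closed subvariety $V\subset\mathbf{A}^2_{\mathbb{R}}$ and a closed subvariety $W\subsetneq G$ such that $\mathcal{V}=V(\mathbb{R})$ and $E(\mathcal{V})\subset W(\mathbb{R})$; and 2. $\mathcal{V}$ cannot be written as $V_1(\mathbb{R})\cup V_2(\mathbb{R})$ with $V_1,V_2\subset\mathbf{A}^2_{\mathbb{R}}$ closed subvarieties such that both inclusions $V_i(\mathbb{R})\subset\mathcal{V}$ are proper. For $t\in\mathbb{R}$ let $L_t=\{(x,y)\in\mathbb{R}^2\mid y=t\}$ and $S_t=\{(x,y)\in\mathbb{R}^2\mid x=t\}$. **Theorem.** Let $\mathcal{V}\subset\mathbb{R}^2$ be a nonempty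 weakly bialgebraic subset which is not a singleton. Then either $\mathcal{V}=L_t$ for some $t\in\mathbb{R}$ or $\mathcal{V}=S_t$ for some $t\in\mathbb{R}$. -/

import Mathlib

noncomputable section

namespace RealExp

open MvPolynomial

/-- The coordinate ring `ℝ[X, Y]` of the affine plane over `ℝ`. Closed subvarieties of the plane are
given by ideals `I` of this ring, and the set of real points of the subvariety given by `I` is
`MvPolynomial.zeroLocus ℝ I`, a subset of `ℝ² = (Fin 2 → ℝ)`. -/
abbrev PlaneRing : Type := MvPolynomial (Fin 2) ℝ

/-- The polynomial `X² + Y²`. -/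
def normPoly : PlaneRing := X 0 ^ 2 + X 1 ^ 2

/-- The coordinate ring `ℝ[X, Y][1 / (X² + Y²)]` of the Weil restriction `G` of the multiplicative
group from `ℂ` to `ℝ`. Closed subvarieties of `G` are given by ideals of this ring. -/
abbrev GRing : Type := Localization.Away normPoly

/-- The real points of `G`, that is `ℝ² ∖ {0}`. -/
abbrev GPoint : Type := {p : Fin 2 → ℝ // p ≠ 0}

theorem isUnit_eval_normPoly (p : GPoint) : IsUnit (MvPolynomial.eval p.1 normPoly) := by
  rw [isUnit_iff_ne_zero]
  intro h
  simp only [normPoly, map_add, map_pow, eval_X] at h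
  apply p.2
  have h0 : p.1 0 = 0 := by nlinarith [sq_nonneg (p.1 0), sq_nonneg (p.1 1)]
  have h1 : p.1 1 = 0 := by nlinarith [sq_nonneg (p.1 0), sq_nonneg (p.1 1)]
  funext i
  fin_cases i
  · exact h0
  · exact h1

/-- Evaluation of a regular function on `G` at a real point of `G`. -/
def GRing.eval (p : GPoint) : GRing →+* ℝ :=
  IsLocalization.Away.lift normPoly (isUnit_eval_normPoly p)

/-- The set `W(ℝ)` of real points of the closed subvariety `W` of `G` given by the ideal `J`. -/
def realPointsG (J : Ideal GRing) : Set GPoint :=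
  {p | ∀ f ∈ J, GRing.eval p f = 0}

/-- The complex number `exp (2πi (x + iy))`. -/
def cexp (v : Fin 2 → ℝ) : ℂ :=
  Complex.exp (2 * Real.pi * Complex.I * ((v 0 : ℂ) + Complex.I * (v 1 : ℂ)))

/-- The map `E : ℝ² → G(ℝ) = ℝ² ∖ {0}`,
`(x, y) ↦ (Re exp (2πi (x + iy)), Im exp (2πi (x + iy)))`. -/
def E (v : Fin 2 → ℝ) : GPoint :=
  ⟨![(cexp v).re, (cexp v).im], fun h =>
    Complex.exp_ne_zero _ (Complex.ext (congrFun h 0) (congrFun h 1))⟩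

/-- A proper subset `S` of `ℝ²` is weakly bialgebraic if it is the set of real points of a closed
subvariety of the plane, its image under `E` is contained in the set of real points of a closed
subvariety `W ⊊ G`, and it is not the union of the sets of real points of two closed subvarieties
of the plane that are both properly contained in `S`. -/
structure IsWeaklyBialgebraic (S : Set (Fin 2 → ℝ)) : Prop where
  ne_univ : S ≠ Set.univ
  algebraic : ∃ I : Ideal PlaneRing, S = zeroLocus ℝ I
  image_subset : ∃ J : Ideal GRing, J ≠ ⊥ ∧ E '' S ⊆ realPointsG J
  irreducible : ¬ ∃ I₁ I₂ : Ideal PlaneRing,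
    S = zeroLocus ℝ I₁ ∪ zeroLocus ℝ I₂ ∧ zeroLocus ℝ I₁ ⊂ S ∧ zeroLocus ℝ I₂ ⊂ S

/-- The horizontal line `L_t = {(x, y) | y = t}`. -/
def horizontalLine (t : ℝ) : Set (Fin 2 → ℝ) := {v | v 1 = t}

/-- The vertical line `S_t = {(x, y) | x = t}`. -/
def verticalLine (t : ℝ) : Set (Fin 2 → ℝ) := {v | v 0 = t}

end RealExp

end

namespace RealExp

open Polynomial Bivariate Filter Topology
open scoped ContDiff

/-! If a nonzero polynomial in `x` alone vanishes on `S`, irreducibility makes `x` constant and `S`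
is a vertical line. Otherwise take a vanishing `P` of least degree in `y`; the implicit function
theorem at a good point puts an analytic arc `y = φ x` inside `S` (`exists_arc`). With `Z = cexp v`,
the equation of `W` becomes a polynomial relation in `Z` and its conjugate, that is, a linear
relation on the arc among exponentials of linear forms in `x` and `φ x`. Repeated differentiation
and elimination (`exists_exp_eq_of_sum_mul_exp_eq_zero`) leave two terms, so `exp β` is a quotient
of polynomials in `x` and `φ x`, where `β` is a difference of two of the forms. These functions have
transcendence degree one over `ℂ`. A nonconstant `β` would make `exp β` algebraic over `ℂ(β)`, which
is impossible (`not_mul_exp_mem_graphAlgebra`). So `β` is constant, and its real and imaginary parts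
force `φ` to be constant. The resulting horizontal segment makes `S` a horizontal line. -/

/-- The bivariate polynomial `f` vanishes on the subset `S` of the plane. -/
def VanishesOn (S : Set (Fin 2 → ℝ)) (f : ℝ[X][Y]) : Prop :=
  ∀ p ∈ S, f.evalEval (p 0) (p 1) = 0

/-! ### Irreducible real algebraic sets in the plane, and lines -/

theorem aeval_equivMvPolynomial (f : ℝ[X][Y]) (p : Fin 2 → ℝ) :
    MvPolynomial.aeval p (equivMvPolynomial ℝ f) = f.evalEval (p 0) (p 1) := by
  have : ((MvPolynomial.aeval p).comp (equivMvPolynomial ℝ : ℝ[X][Y] →ₐ[ℝ] _)) =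
      aevalAeval (p 0) (p 1) := by
    ext <;> simp
  rw [← coe_aevalAeval_eq_evalEval, ← this]
  rfl

theorem evalEval_equivMvPolynomial_symm (f : PlaneRing) (p : Fin 2 → ℝ) :
    ((equivMvPolynomial ℝ).symm f).evalEval (p 0) (p 1) = MvPolynomial.aeval p f := by
  rw [← aeval_equivMvPolynomial, AlgEquiv.apply_symm_apply]

theorem IsWeaklyBialgebraic.mem_of_forall {S : Set (Fin 2 → ℝ)} (hS : IsWeaklyBialgebraic S)
    {p : Fin 2 → ℝ} (hp : ∀ f, VanishesOn S f → f.evalEval (p 0) (p 1) = 0) : p ∈ S := by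
  obtain ⟨I, hI⟩ := hS.algebraic
  rw [hI]
  intro f hf
  rw [← evalEval_equivMvPolynomial_symm]
  refine hp _ fun q hq => ?_
  rw [evalEval_equivMvPolynomial_symm]
  rw [hI] at hq
  exact hq f hf

/-- Adding `f` or `g` to an ideal of `S` cuts out two closed pieces covering `S`, and irreducibility
forbids both from being proper. So the polynomials vanishing on `S` behave like a prime ideal. -/
theorem IsWeaklyBialgebraic.vanishesOn_or {S : Set (Fin 2 → ℝ)} (hS : IsWeaklyBialgebraic S)
    {f g : ℝ[X][Y]} (h : VanishesOn S (f * g)) : VanishesOn S f ∨ VanishesOn S g := by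
  obtain ⟨I, hI⟩ := hS.algebraic
  have key : ∀ f : ℝ[X][Y], MvPolynomial.zeroLocus ℝ (I ⊔ Ideal.span {equivMvPolynomial ℝ f}) =
      {p ∈ S | f.evalEval (p 0) (p 1) = 0} := by
    intro f
    ext p
    constructor
    · intro hp
      refine ⟨hI ▸ MvPolynomial.zeroLocus_anti_mono le_sup_left hp, ?_⟩
      rw [← aeval_equivMvPolynomial]
      exact hp _ (Ideal.mem_sup_right (Ideal.mem_span_singleton_self _))
    · rintro ⟨hp, hf⟩ q hq
      obtain ⟨a, ha, b, hb, rfl⟩ := Submodule.mem_sup.1 hq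
      obtain ⟨c, rfl⟩ := Ideal.mem_span_singleton'.1 hb
      rw [hI] at hp
      rw [map_add, map_mul, aeval_equivMvPolynomial, hf, hp a ha]
      simp
  by_contra! hcon
  obtain ⟨hf, hg⟩ := hcon
  refine hS.irreducible ⟨I ⊔ Ideal.span {equivMvPolynomial ℝ f},
    I ⊔ Ideal.span {equivMvPolynomial ℝ g}, ?_, ?_, ?_⟩
  · rw [key, key]
    ext p
    constructor
    · intro hp
      have := h p hp
      rw [evalEval_mul, mul_eq_zero] at this
      exact this.imp (fun h => ⟨hp, h⟩) (fun h => ⟨hp, h⟩)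
    · rintro (hp | hp) <;> exact hp.1
  · rw [key]
    exact ⟨fun p hp => hp.1, fun h => hf fun p hp => (h hp).2⟩
  · rw [key]
    exact ⟨fun p hp => hp.1, fun h => hg fun p hp => (h hp).2⟩

theorem IsWeaklyBialgebraic.exists_vanishesOn {S : Set (Fin 2 → ℝ)}
    (hS : IsWeaklyBialgebraic S) : ∃ f, f ≠ 0 ∧ VanishesOn S f := by
  by_contra! h
  refine hS.ne_univ (Set.eq_univ_of_forall fun p => hS.mem_of_forall fun f hf => ?_)
  by_cases h0 : f = 0
  · simp [h0]
  · exact absurd hf (h f h0)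

/-- A one-variable polynomial in one of the two coordinates vanishing on `S` forces that
coordinate to be constant. -/
theorem IsWeaklyBialgebraic.exists_eq_of_eval_eq_zero {S : Set (Fin 2 → ℝ)}
    (hS : IsWeaklyBialgebraic S) (hne : S.Nonempty) (ℓ : ℝ[X][Y]) {p : ℝ[X]} (hp0 : p ≠ 0)
    (hp : ∀ v ∈ S, p.eval (ℓ.evalEval (v 0) (v 1)) = 0) :
    ∃ t, ∀ v ∈ S, ℓ.evalEval (v 0) (v 1) = t := by
  induction hn : p.natDegree using Nat.strong_induction_on generalizing p with
  | _ n ih =>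
  obtain ⟨v, hv⟩ := hne
  set r := ℓ.evalEval (v 0) (v 1) with hr
  -- The value at one point of `S` is a root of `p`. Either `X - r` already vanishes along `S`, or
  -- the cofactor, of smaller degree, does.
  obtain ⟨q, rfl⟩ := dvd_iff_isRoot.2 (hp v hv : p.IsRoot r)
  have hq0 : q ≠ 0 := right_ne_zero_of_mul hp0
  have hcomp : ∀ (q : ℝ[X]) (w : Fin 2 → ℝ), (aeval ℓ q).evalEval (w 0) (w 1) =
      q.eval (ℓ.evalEval (w 0) (w 1)) := by
    intro q w
    rw [← coe_aevalAeval_eq_evalEval, ← aeval_algHom_apply, coe_aeval_eq_eval]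
  have h := hS.vanishesOn_or (f := aeval ℓ (X - C r))
    (g := aeval ℓ q) (fun w hw => by
      rw [evalEval_mul, hcomp, hcomp, ← eval_mul]; exact hp w hw)
  rcases h with h | h
  · refine ⟨r, fun w hw => ?_⟩
    have := h w hw
    rw [hcomp] at this
    simpa [sub_eq_zero] using this
  · refine ih q.natDegree ?_ hq0 (fun w hw => ?_) rfl
    · rw [← hn, natDegree_mul (X_sub_C_ne_zero r) hq0, natDegree_X_sub_C]; omega
    · rw [← hcomp]; exact h w hw

/-- On `S` the polynomial `ℓ` inverts the parametrization `γ`. If some `f` vanishing on `S` had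
nonzero pullback along `γ`, then `ℓ` would be constant on `S` and `S` would be a point. -/
theorem IsWeaklyBialgebraic.eq_line {S : Set (Fin 2 → ℝ)}
    (hS : IsWeaklyBialgebraic S) (hne : S.Nonempty) (hpt : ∀ p : Fin 2 → ℝ, S ≠ {p})
    {γ : ℝ → Fin 2 → ℝ} (ℓ : ℝ[X][Y]) (h : ∀ v ∈ S, v = γ (ℓ.evalEval (v 0) (v 1)))
    (hγ : ∀ f : ℝ[X][Y], ∃ g : ℝ[X], ∀ s, g.eval s = f.evalEval (γ s 0) (γ s 1)) :
    ∀ s, γ s ∈ S := by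
  intro s
  refine hS.mem_of_forall fun f hf => ?_
  obtain ⟨g, hg⟩ := hγ f
  rw [← hg]
  by_cases hg0 : g = 0
  · simp [hg0]
  exfalso
  obtain ⟨t, ht⟩ := hS.exists_eq_of_eval_eq_zero hne ℓ hg0 (fun v hv => by
    rw [hg, ← h v hv]; exact hf v hv)
  refine hpt (γ t) (Set.eq_singleton_iff_nonempty_unique_mem.2 ⟨hne, fun v hv => ?_⟩)
  rw [h v hv, ht v hv]

theorem IsWeaklyBialgebraic.eq_verticalLine {S : Set (Fin 2 → ℝ)}
    (hS : IsWeaklyBialgebraic S) (hne : S.Nonempty) (hpt : ∀ p : Fin 2 → ℝ, S ≠ {p}) {t : ℝ}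
    (h : ∀ v ∈ S, v 0 = t) : S = verticalLine t := by
  refine Set.Subset.antisymm h fun v (hv : v 0 = t) => ?_
  have := hS.eq_line hne hpt (γ := fun s => ![t, s]) Y (fun v hv => by
    ext i; fin_cases i <;> simp [h v hv]) (fun f => ⟨f.map (evalRingHom t), fun s => by
      simp [map_evalRingHom_eval]⟩) (v 1)
  convert this using 1
  ext i; fin_cases i <;> simp [hv]

theorem IsWeaklyBialgebraic.eq_horizontalLine {S : Set (Fin 2 → ℝ)}
    (hS : IsWeaklyBialgebraic S) (hne : S.Nonempty) (hpt : ∀ p : Fin 2 → ℝ, S ≠ {p}) {t : ℝ}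
    (h : ∀ v ∈ S, v 1 = t) : S = horizontalLine t := by
  refine Set.Subset.antisymm h fun v (hv : v 1 = t) => ?_
  have := hS.eq_line hne hpt (γ := fun s => ![s, t]) (C X) (fun v hv => by
    ext i; fin_cases i <;> simp [h v hv, evalEval_C]) (fun f => ⟨f.eval (C t), fun s => by
      simp [evalEval]⟩) (v 0)
  convert this using 1
  ext i; fin_cases i <;> simp [hv]

/-! ### Analytic arcs in `S` -/

/-- If no nonzero polynomial in the abscissa vanishes on `S`, a vanishing polynomial of minimal
degree in the ordinate locally cuts out `S`. -/
theorem IsWeaklyBialgebraic.mem_of_minimal {S : Set (Fin 2 → ℝ)} (hS : IsWeaklyBialgebraic S)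
    {P : ℝ[X][Y]} (hPS : VanishesOn S P)
    (hmin : ∀ f, f ≠ 0 → VanishesOn S f → P.natDegree ≤ f.natDegree)
    (hdeg : 0 < P.natDegree) {p : Fin 2 → ℝ} (hp : P.evalEval (p 0) (p 1) = 0)
    (hlead : P.leadingCoeff.eval (p 0) ≠ 0) : p ∈ S := by
  refine hS.mem_of_forall fun f hf => ?_
  induction hn : f.natDegree using Nat.strong_induction_on generalizing f with
  | _ n ih =>
  by_cases hf0 : f = 0
  · simp [hf0]
  have hle := hmin f hf0 hf
  -- One step of pseudo-division by `P` in `y`: leading terms cancel, and at `p` only the leading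
  -- coefficient of `P` times `f` survives.
  set g := C P.leadingCoeff * f - C f.leadingCoeff * Y ^ (f.natDegree - P.natDegree) * P with hg
  have hgS : VanishesOn S g := fun q hq => by
    simp [hg, hf q hq, hPS q hq]
  have hglt : g.natDegree < n := by
    have hP0 : P ≠ 0 := by rintro rfl; simp at hdeg
    have hlP : P.leadingCoeff ≠ 0 := leadingCoeff_ne_zero.2 hP0
    have hlf : f.leadingCoeff ≠ 0 := leadingCoeff_ne_zero.2 hf0
    have hA : C P.leadingCoeff * f ≠ 0 := mul_ne_zero (C_ne_zero.2 hlP) hf0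
    have hB : C f.leadingCoeff * Y ^ (f.natDegree - P.natDegree) * P ≠ 0 :=
      mul_ne_zero (mul_ne_zero (C_ne_zero.2 hlf) (pow_ne_zero _ X_ne_zero)) hP0
    have hdA : (C P.leadingCoeff * f).natDegree = n := by rw [natDegree_C_mul hlP, hn]
    by_cases hg0 : g = 0
    · rw [hg0, natDegree_zero]; omega
    rw [← hdA]
    refine natDegree_lt_natDegree hg0 (degree_sub_lt_left ?_ hA ?_)
    · rw [degree_eq_natDegree hA, degree_eq_natDegree hB, hdA, mul_assoc, natDegree_C_mul hlf,
        natDegree_mul (pow_ne_zero _ X_ne_zero) hP0, natDegree_X_pow]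
      congr 1
      omega
    · simp only [leadingCoeff_mul, leadingCoeff_C, leadingCoeff_X_pow, mul_one]
      exact mul_comm _ _
  have := ih _ hglt g hgS rfl
  simp only [hg, evalEval_sub, evalEval_mul, hp, mul_zero, sub_zero, evalEval_C] at this
  exact (mul_eq_zero.1 this).resolve_left hlead

theorem contDiff_evalEval (P : ℝ[X][Y]) :
    ContDiff ℝ ω (fun u : ℝ × ℝ => P.evalEval u.1 u.2) := by
  induction P using Polynomial.induction_on' with
  | add p q hp hq => simpa only [evalEval_add] using hp.add hq
  | monomial n a =>
    simp only [← C_mul_X_pow_eq_monomial, evalEval_mul, evalEval_pow, evalEval_C, evalEval_X]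
    have : ContDiff ℝ ω (fun x : ℝ => a.eval x) := by
      simpa using! a.contDiff_aeval (𝕜 := ℝ) ω
    exact (this.comp contDiff_fst).mul (contDiff_snd.pow n)

theorem hasDerivAt_evalEval_right (P : ℝ[X][Y]) (x y : ℝ) :
    HasDerivAt (fun y => P.evalEval x y) ((derivative P).evalEval x y) y := by
  simp only [← map_evalRingHom_eval, ← derivative_map]
  exact Polynomial.hasDerivAt _ _

/-- Near a zero at which the derivative in the ordinate does not vanish, the zero set of a
bivariate polynomial contains the graph of an analytic function. -/
theorem exists_analyticAt_evalEval_eq_zero (P : ℝ[X][Y]) {x₀ y₀ : ℝ} (h : P.evalEval x₀ y₀ = 0)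
    (h' : (derivative P).evalEval x₀ y₀ ≠ 0) :
    ∃ φ : ℝ → ℝ, AnalyticAt ℝ φ x₀ ∧ φ x₀ = y₀ ∧ ∀ᶠ x in 𝓝 x₀, P.evalEval x (φ x) = 0 := by
  set f : ℝ × ℝ → ℝ := fun u => P.evalEval u.1 u.2 with hf
  have cdf : ContDiffAt ℝ ω f (x₀, y₀) := (contDiff_evalEval P).contDiffAt
  have hd : HasFDerivAt f (fderiv ℝ f (x₀, y₀)) (x₀, y₀) :=
    (cdf.differentiableAt (by simp)).hasFDerivAt
  -- The partial derivative in `y` is multiplication by a nonzero real, hence invertible.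
  have h2 : (fderiv ℝ f (x₀, y₀) ∘L .inr ℝ ℝ ℝ) =
      (ContinuousLinearEquiv.unitsEquivAut ℝ (Units.mk0 _ h') : ℝ →L[ℝ] ℝ) := by
    ext
    have e1 : HasDerivAt (fun y => f (x₀, y)) (fderiv ℝ f (x₀, y₀) (0, 1)) y₀ :=
      hd.comp_hasDerivAt y₀ ((hasDerivAt_const y₀ x₀).prodMk (hasDerivAt_id y₀))
    have e2 := e1.unique (hasDerivAt_evalEval_right P x₀ y₀)
    simpa using e2
  have hinv : (fderiv ℝ f (x₀, y₀) ∘L .inr ℝ ℝ ℝ).IsInvertible := ⟨_, h2.symm⟩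
  refine ⟨cdf.implicitFunction (by simp) hinv, ?_, ?_, ?_⟩
  · exact (cdf.contDiffAt_implicitFunction (by simp) hinv).analyticAt
  · exact cdf.implicitFunction_apply_self (by simp) hinv
  · have := cdf.eventually_apply_implicitFunction (by simp) hinv
    filter_upwards [this] with x hx
    exact hx.trans h

/-- A weakly bialgebraic set that is not contained in finitely many vertical lines contains an
analytic arc which is a graph over the abscissa. -/
theorem IsWeaklyBialgebraic.exists_arc {S : Set (Fin 2 → ℝ)} (hS : IsWeaklyBialgebraic S)
    (hx : ∀ p : ℝ[X], p ≠ 0 → ¬ VanishesOn S (C p)) :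
    ∃ (P : ℝ[X][Y]) (x₀ : ℝ) (φ : ℝ → ℝ), VanishesOn S P ∧ P ≠ 0 ∧
      (∀ f, f ≠ 0 → VanishesOn S f → P.natDegree ≤ f.natDegree) ∧ AnalyticAt ℝ φ x₀ ∧
      ∀ᶠ x in 𝓝 x₀, ![x, φ x] ∈ S ∧ (derivative P).evalEval x (φ x) ≠ 0 := by
  classical
  obtain ⟨f₀, hf₀⟩ := hS.exists_vanishesOn
  have hex : ∃ n, ∃ f : ℝ[X][Y], (f ≠ 0 ∧ VanishesOn S f) ∧ f.natDegree = n := ⟨_, f₀, hf₀, rfl⟩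
  obtain ⟨P, ⟨hP0, hPS⟩, hPn⟩ := Nat.find_spec hex
  have hmin : ∀ f, f ≠ 0 → VanishesOn S f → P.natDegree ≤ f.natDegree := fun f h0 hf => by
    rw [hPn]; exact Nat.find_min' hex ⟨f, ⟨h0, hf⟩, rfl⟩
  have hdeg : 0 < P.natDegree := by
    rw [pos_iff_ne_zero]
    intro h0
    rw [eq_C_of_natDegree_eq_zero h0] at hPS hP0
    exact hx _ (by simpa using hP0) hPS
  -- The first factor depends on `x` only, and the second is nonzero of degree below the minimum.
  -- Neither vanishes on `S`, so by primality some point of `S` avoids both zero sets.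
  have hnot : ¬ VanishesOn S (C P.leadingCoeff * derivative P) := by
    intro h
    rcases hS.vanishesOn_or h with h | h
    · exact hx _ (leadingCoeff_ne_zero.2 hP0) h
    · have := hmin _ (fun h0 => hdeg.ne' (derivative_eq_zero.1 h0)) h
      exact absurd (natDegree_derivative_lt hdeg.ne') (not_lt.2 this)
  simp only [VanishesOn, not_forall] at hnot
  obtain ⟨p, hpS, hp⟩ := hnot
  rw [evalEval_mul, evalEval_C, mul_eq_zero, not_or] at hp
  obtain ⟨φ, hφ, hφ0, hφP⟩ := exists_analyticAt_evalEval_eq_zero P (hPS p hpS) hp.2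
  refine ⟨P, p 0, φ, hPS, hP0, hmin, hφ, ?_⟩
  have h1 : ∀ᶠ x in 𝓝 (p 0), P.leadingCoeff.eval x ≠ 0 :=
    P.leadingCoeff.continuous.continuousAt.eventually_ne hp.1
  have h2 : ∀ᶠ x in 𝓝 (p 0), (derivative P).evalEval x (φ x) ≠ 0 := by
    have hc : ContinuousAt (fun x => (derivative P).evalEval x (φ x)) (p 0) :=
      ContinuousAt.comp (g := fun u : ℝ × ℝ => (derivative P).evalEval u.1 u.2)
        (contDiff_evalEval _).continuous.continuousAt
        (continuousAt_id.prodMk hφ.continuousAt)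
    exact hc.eventually_ne (by rw [hφ0]; exact hp.2)
  filter_upwards [h1, h2, hφP] with x hx1 hx2 hx3
  exact ⟨hS.mem_of_minimal hPS hmin hdeg (by simpa using hx3) (by simpa using hx1), hx2⟩

/-- A horizontal segment in `S` forces the ordinate to be constant on `S`. -/
theorem IsWeaklyBialgebraic.vanishesOn_of_segment {S : Set (Fin 2 → ℝ)}
    (hS : IsWeaklyBialgebraic S) {P : ℝ[X][Y]} (hPS : VanishesOn S P) (hP0 : P ≠ 0)
    (hmin : ∀ f, f ≠ 0 → VanishesOn S f → P.natDegree ≤ f.natDegree) {x₀ c : ℝ}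
    (hc : ∀ᶠ x in 𝓝 x₀, ![x, c] ∈ S) : VanishesOn S (Y - C (C c)) := by
  have hroot : P.IsRoot (C c) := by
    refine eq_zero_of_infinite_isRoot _ (Set.Infinite.mono (s := {x | ![x, c] ∈ S}) ?_ ?_)
    · intro x hx
      simpa using! hPS _ hx
    · exact infinite_of_mem_nhds x₀ hc
  -- `Y - c` divides `P`, and the cofactor has too small a degree to vanish on `S`.
  obtain ⟨q, rfl⟩ := dvd_iff_isRoot.2 hroot
  have hq0 : q ≠ 0 := right_ne_zero_of_mul hP0
  refine (hS.vanishesOn_or hPS).resolve_right fun hq => ?_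
  have := hmin q hq0 hq
  rw [natDegree_mul (X_sub_C_ne_zero _) hq0, natDegree_X_sub_C] at this
  omega

/-! ### Eliminating exponentials -/

/-- Two analytic functions with vanishing Wronskian are proportional. -/
theorem exists_eqOn_mul_of_wronskian_eq_zero {J : Set ℝ} (hJ : IsOpen J) (hJc : IsPreconnected J)
    {F G : ℝ → ℂ} (hF : AnalyticOnNhd ℝ F J) (hG : AnalyticOnNhd ℝ G J) (hG0 : ¬ J.EqOn G 0)
    (h : ∀ t ∈ J, deriv F t * G t = F t * deriv G t) : ∃ c : ℂ, ∀ t ∈ J, F t = c * G t := by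
  simp only [Set.EqOn, not_forall] at hG0
  obtain ⟨t₀, ht₀, hGt⟩ := hG0
  have hev : ∀ᶠ t in 𝓝 t₀, t ∈ J ∧ G t ≠ 0 :=
    (show ∀ᶠ t in 𝓝 t₀, t ∈ J from hJ.mem_nhds ht₀).and ((hG t₀ ht₀).continuousAt.eventually_ne hGt)
  obtain ⟨ε, hε, hball⟩ := Metric.eventually_nhds_iff_ball.1 hev
  obtain ⟨c, hc⟩ := Metric.isOpen_ball.exists_is_const_of_deriv_eq_zero (𝕜 := ℝ)
    (f := fun t => F t / G t) (convex_ball t₀ ε).isPreconnected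
    (fun t ht => ((hF t (hball t ht).1).differentiableAt.div (hG t (hball t ht).1).differentiableAt
      (hball t ht).2).differentiableWithinAt)
    (fun t ht => by
      have hd := (hF t (hball t ht).1).differentiableAt.hasDerivAt.div
        (hG t (hball t ht).1).differentiableAt.hasDerivAt (hball t ht).2
      rw [h t (hball t ht).1, sub_self, zero_div] at hd
      exact hd.deriv)
  refine ⟨c, hF.eqOn_of_preconnected_of_eventuallyEq (g := fun t => c * G t)
    (analyticOnNhd_const.mul hG) hJc ht₀ ?_⟩
  filter_upwards [Metric.ball_mem_nhds t₀ hε] with t ht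
  exact (div_eq_iff (hball t ht).2).1 (hc t ht)

/-- A linear relation among exponentials of functions from a differential algebra `B` of analytic
functions, with coefficients from `B`, makes the quotient of two of the exponentials a quotient of
elements of `B`. -/
theorem exists_exp_eq_of_sum_mul_exp_eq_zero {J : Set ℝ} (hJ : IsOpen J) (hJc : IsPreconnected J)
    {B : Subalgebra ℂ (ℝ → ℂ)} (hBa : ∀ f ∈ B, AnalyticOnNhd ℝ f J) {δ : ℝ → ℂ}
    (hδ : ∀ t ∈ J, δ t ≠ 0) (hBd : ∀ f ∈ B, ∃ g ∈ B, ∀ t ∈ J, g t = δ t * deriv f t)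
    {ι : Type*} (s : Finset ι) (f α : ι → ℝ → ℂ) (hf : ∀ i ∈ s, f i ∈ B) (hα : ∀ i ∈ s, α i ∈ B)
    (hf0 : ∀ i ∈ s, ¬ J.EqOn (f i) 0) (hs : s.Nonempty)
    (h : ∀ t ∈ J, ∑ i ∈ s, f i t * Complex.exp (α i t) = 0) :
    ∃ i ∈ s, ∃ j ∈ s, i ≠ j ∧ ∃ F ∈ B, ∃ G ∈ B, ¬ J.EqOn F 0 ∧
      ∀ t ∈ J, F t * Complex.exp (α i t) = G t * Complex.exp (α j t) := by
  classical
  induction hn : s.card using Nat.strong_induction_on generalizing s f with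
  | _ n ih =>
  obtain ⟨k, hk⟩ := hs
  have hu : ∀ i, ∃ u : ℝ → ℂ, i ∈ s → u ∈ B ∧ ∀ t ∈ J,
      HasDerivAt (fun t => f i t * Complex.exp (α i t))
        ((δ t)⁻¹ * (u t * Complex.exp (α i t))) t := by
    intro i
    by_cases hi : i ∈ s
    swap
    · exact ⟨0, fun h => absurd h hi⟩
    obtain ⟨a, ha, haf⟩ := hBd _ (hf i hi)
    obtain ⟨b, hb, hbf⟩ := hBd _ (hα i hi)
    refine ⟨a + f i * b, fun _ => ⟨B.add_mem ha (B.mul_mem (hf i hi) hb), fun t ht => ?_⟩⟩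
    have h1 := (hBa _ (hf i hi) t ht).differentiableAt.hasDerivAt
    have h2 := (hBa _ (hα i hi) t ht).differentiableAt.hasDerivAt
    convert! h1.mul h2.cexp using 1
    have := hδ t ht
    simp only [Pi.add_apply, Pi.mul_apply, haf t ht, hbf t ht]
    field_simp
  choose u hu using hu
  have hsum : ∀ t ∈ J, ∑ i ∈ s, u i t * Complex.exp (α i t) = 0 := by
    intro t ht
    have h1 : HasDerivAt (fun t => ∑ i ∈ s, f i t * Complex.exp (α i t))
        (∑ i ∈ s, (δ t)⁻¹ * (u i t * Complex.exp (α i t))) t :=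
      HasDerivAt.fun_sum fun i hi => (hu i hi).2 t ht
    have h2 : (fun t => ∑ i ∈ s, f i t * Complex.exp (α i t)) =ᶠ[𝓝 t] fun _ => 0 := by
      filter_upwards [hJ.mem_nhds ht] with t' ht' using h t' ht'
    have h3 := h1.unique ((hasDerivAt_const t (0 : ℂ)).congr_of_eventuallyEq h2)
    rw [← Finset.mul_sum] at h3
    exact (mul_eq_zero.1 h3).resolve_left (inv_ne_zero (hδ t ht))
  -- Subtracting multiples of the original and differentiated relations kills the term `k`. Either a
  -- shorter nontrivial relation remains, or every `g i` vanishes and the terms have zero Wronskian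
  -- with term `k`.
  set g : ι → ℝ → ℂ := fun i => f k * u i - f i * u k with hg
  have hgB : ∀ i ∈ s, g i ∈ B := fun i hi =>
    B.sub_mem (B.mul_mem (hf k hk) (hu i hi).1) (B.mul_mem (hf i hi) (hu k hk).1)
  have hgsum : ∀ t ∈ J, ∑ i ∈ s, g i t * Complex.exp (α i t) = 0 := by
    intro t ht
    have : ∀ i ∈ s, g i t * Complex.exp (α i t) =
        f k t * (u i t * Complex.exp (α i t)) - u k t * (f i t * Complex.exp (α i t)) := by
      intro i _
      simp only [hg, Pi.sub_apply, Pi.mul_apply]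
      ring
    rw [Finset.sum_congr rfl this, Finset.sum_sub_distrib, ← Finset.mul_sum, ← Finset.mul_sum,
      hsum t ht, h t ht]
    simp
  set s' := s.filter fun i => ¬ J.EqOn (g i) 0 with hs'
  by_cases hne : s'.Nonempty
  · have hks : k ∉ s' := by
      intro hk'
      refine (Finset.mem_filter.1 hk').2 fun t _ => ?_
      simp only [hg, Pi.sub_apply, Pi.mul_apply, Pi.zero_apply]
      ring
    have hsub : s' ⊂ s := ⟨Finset.filter_subset _ _, fun hss => hks (hss hk)⟩
    obtain ⟨i, hi, j, hj, hij⟩ := ih s'.card (hn ▸ Finset.card_lt_card hsub) s' g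
      (fun i hi => hgB i (hsub.1 hi)) (fun i hi => hα i (hsub.1 hi))
      (fun i hi => (Finset.mem_filter.1 hi).2) hne (fun t ht => by
        rw [← hgsum t ht, hs', Finset.sum_filter_of_ne]
        intro i _ hne0 h0
        exact hne0 (by rw [h0 ht]; simp)) rfl
    exact ⟨i, hsub.1 hi, j, hsub.1 hj, hij⟩
  · have hg0 : ∀ i ∈ s, ∀ t ∈ J, g i t = 0 := by
      intro i hi
      by_contra hcon
      exact hne ⟨i, Finset.mem_filter.2 ⟨hi, hcon⟩⟩
    have hik : ∃ i ∈ s, i ≠ k := by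
      by_contra! hcon
      have hsk : s = {k} := Finset.eq_singleton_iff_unique_mem.2 ⟨hk, hcon⟩
      refine hf0 k hk fun t ht => ?_
      have := h t ht
      rw [hsk, Finset.sum_singleton] at this
      exact (mul_eq_zero.1 this).resolve_right (Complex.exp_ne_zero _)
    obtain ⟨i, hi, hik⟩ := hik
    have han : ∀ j ∈ s, AnalyticOnNhd ℝ (fun t => f j t * Complex.exp (α j t)) J := fun j hj =>
      (hBa _ (hf j hj)).mul fun t ht =>
        (analyticAt_cexp.restrictScalars (𝕜 := ℝ)).comp (hBa _ (hα j hj) t ht)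
    obtain ⟨c, hc⟩ := exists_eqOn_mul_of_wronskian_eq_zero hJ hJc (han i hi) (han k hk)
      (fun h0 => hf0 k hk fun t ht =>
        (mul_eq_zero.1 (h0 ht)).resolve_right (Complex.exp_ne_zero _))
      (fun t ht => by
        rw [((hu i hi).2 t ht).deriv, ((hu k hk).2 t ht).deriv]
        have := hg0 i hi t ht
        simp only [hg, Pi.sub_apply, Pi.mul_apply] at this
        linear_combination (δ t)⁻¹ * Complex.exp (α i t) * Complex.exp (α k t) * this)
    refine ⟨i, hi, k, hk, hik, f i, hf i hi, c • f k, B.smul_mem (hf k hk) c, hf0 i hi,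
      fun t ht => ?_⟩
    rw [hc t ht, Pi.smul_apply, smul_eq_mul, mul_assoc]

/-! ### Transcendence degree one, and independence of `z` and `exp z` -/

/-- The algebra of functions on `J` that extend to real-analytic functions. -/
def analyticSubalgebra (J : Set ℝ) : Subalgebra ℂ (J → ℂ) where
  carrier := {f | ∃ g : ℝ → ℂ, AnalyticOnNhd ℝ g J ∧ ∀ t : J, f t = g t}
  mul_mem' := by
    rintro a b ⟨f, hf, hf'⟩ ⟨g, hg, hg'⟩
    exact ⟨f * g, hf.mul hg, fun t => by simp [hf', hg']⟩
  add_mem' := by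
    rintro a b ⟨f, hf, hf'⟩ ⟨g, hg, hg'⟩
    exact ⟨f + g, hf.add hg, fun t => by simp [hf', hg']⟩
  algebraMap_mem' c := ⟨fun _ => c, analyticOnNhd_const, fun _ => rfl⟩

/-- The restriction to `J` of a function that is analytic on `J`. -/
def restrictAnalytic {J : Set ℝ} (f : ℝ → ℂ) (hf : AnalyticOnNhd ℝ f J) : analyticSubalgebra J :=
  ⟨fun t => f t, f, hf, fun _ => rfl⟩

/-- The identity theorem on the connected set `J`. Functions are restricted to `J` because their
values elsewhere could create zero divisors. -/
theorem isDomain_analyticSubalgebra {J : Set ℝ} (hJc : IsPreconnected J) (hne : J.Nonempty) :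
    IsDomain (analyticSubalgebra J) := by
  have : Nonempty J := hne.to_subtype
  have : NoZeroDivisors (analyticSubalgebra J) := by
    constructor
    rintro ⟨a, f, hf, hf'⟩ ⟨b, g, hg, hg'⟩ hab
    have hab' : ∀ t : J, a t * b t = 0 := fun t => congrFun (congrArg Subtype.val hab) t
    have := hf.eq_zero_or_eq_zero_of_smul_eq_zero hg (fun t ht => by
      simpa [hf', hg'] using hab' ⟨t, ht⟩) hJc
    refine this.imp (fun h => ?_) (fun h => ?_)
    · exact Subtype.ext (funext fun t => (hf' t).trans (h t t.2))
    · exact Subtype.ext (funext fun t => (hg' t).trans (h t t.2))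
  exact NoZeroDivisors.to_isDomain _

theorem transcendental_of_not_mem_range {A : Type*} [CommRing A] [IsDomain A] [Algebra ℂ A] {a : A}
    (h : ∀ c, algebraMap ℂ A c ≠ a) : Transcendental ℂ a := by
  intro ha
  have hi : IsIntegral ℂ a := ha.isIntegral
  obtain ⟨c, hc⟩ := minpoly.mem_range_of_degree_eq_one ℂ a
    (IsAlgClosed.degree_eq_one_of_irreducible ℂ (minpoly.irreducible hi))
  exact h c hc

/-- In transcendence degree one, every element is algebraic over any transcendental one. -/
theorem isAlgebraic_adjoin_singleton_of_transcendental {k A : Type*} [Field k] [CommRing A]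
    [IsDomain A] [Algebra k A] {x y β w F : A} (hy : IsAlgebraic (Algebra.adjoin k {x}) y)
    (hβ : β ∈ Algebra.adjoin k {x, y}) (hβt : Transcendental k β)
    (hF : F ∈ Algebra.adjoin k {x, y}) (hF0 : F ≠ 0) (hG : F * w ∈ Algebra.adjoin k {x, y}) :
    IsAlgebraic (Algebra.adjoin k {β}) w := by
  let M := AlgebraicIndependent.matroid k A
  have hcl : ∀ (s : Set A) (a : A), a ∈ M.closure s ↔ IsAlgebraic (Algebra.adjoin k s) a := by
    intro s a
    rw [AlgebraicIndependent.matroid_closure_eq]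
    rfl
  have hyx : y ∈ M.closure {x} := (hcl _ _).2 hy
  have hxy : M.closure {x, y} = M.closure {x} := by
    rw [Set.pair_comm, Matroid.closure_insert_eq_of_mem_closure hyx]
  have hmem : ∀ a ∈ Algebra.adjoin k {x, y}, a ∈ M.closure {x} := fun a ha => by
    rw [← hxy, hcl]
    exact isAlgebraic_algebraMap (⟨a, ha⟩ : Algebra.adjoin k {x, y})
  have hβ0 : β ∉ M.closure ∅ := by
    rw [hcl]
    intro h
    refine hβt ?_
    have : Algebra.IsAlgebraic k (Algebra.adjoin k (∅ : Set A)) := by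
      constructor
      rintro ⟨a, ha⟩
      obtain ⟨c, rfl⟩ := Algebra.mem_bot.1 (Algebra.adjoin_empty k A ▸ ha)
      exact isAlgebraic_algebraMap c
    exact h.restrictScalars k
  -- Matroid exchange: `β` lies in the closure of `x` but not in that of the empty set, so it can
  -- replace `x`.
  have hex : M.closure {β} = M.closure {x} := by
    simpa using Matroid.closure_insert_congr (M := M) (X := ∅) (e := β) (f := x)
      ⟨by simpa using hmem β hβ, hβ0⟩
  have hw : w ∈ M.closure {x} := by
    rw [← hxy, hcl]
    -- `w` is a root of the linear polynomial `F * X - F * w`.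
    refine ⟨C ⟨F, hF⟩ * X - C ⟨F * w, hG⟩, fun h0 => hF0 ?_, ?_⟩
    · simpa using congrArg (fun p => (p.coeff 1 : A)) h0
    · simp [Algebra.algebraMap_eq_smul_one, Subalgebra.smul_def]
  rwa [← hcl, hex]

theorem exists_bivariate_of_isAlgebraic_adjoin {k A : Type*} [Field k] [CommRing A] [Algebra k A]
    {β w : A} (h : IsAlgebraic (Algebra.adjoin k {β}) w) :
    ∃ R : k[X][Y], R ≠ 0 ∧ aevalAeval β w R = 0 := by
  obtain ⟨q, hq0, hq⟩ := h
  let ψ : k[X] →ₐ[k] Algebra.adjoin k {β} :=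
    aeval (⟨β, Algebra.self_mem_adjoin_singleton k β⟩ : Algebra.adjoin k {β})
  have hψ : ∀ p, (ψ p : A) = aeval β p := fun p => by
    rw [← Subalgebra.coe_val, ← AlgHom.comp_apply]
    simp [ψ]
  have hsurj : Function.Surjective (ψ : k[X] →+* Algebra.adjoin k {β}) := by
    rintro ⟨a, ha⟩
    rw [Algebra.adjoin_singleton_eq_range_aeval] at ha
    obtain ⟨p, hp⟩ := ha
    exact ⟨p, Subtype.ext ((hψ p).trans hp)⟩
  obtain ⟨R, rfl⟩ := Polynomial.map_surjective _ hsurj q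
  refine ⟨R, fun h0 => hq0 (by simp [h0]), ?_⟩
  have : aevalAeval β w = ((aeval (R := Algebra.adjoin k {β}) w).restrictScalars k).comp
      (mapAlgHom ψ) := by
    ext <;> simp [ψ, Subalgebra.algebraMap_eq]
  rw [← hq, this]
  rfl

/-- The functions `z` and `exp z` satisfy no polynomial relation on a nontrivial connected set. -/
theorem eq_zero_of_evalEval_exp_eq_zero {R : ℂ[X][Y]} {T : Set ℂ} (hT : IsPreconnected T)
    (hT' : T.Nontrivial) (h : ∀ z ∈ T, R.evalEval z (Complex.exp z) = 0) : R = 0 := by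
  have han : AnalyticOnNhd ℂ (fun z => R.evalEval z (Complex.exp z)) Set.univ := by
    clear h
    induction R using Polynomial.induction_on' with
    | add p q hp hq => simpa only [evalEval_add] using! hp.add hq
    | monomial n a =>
      simp only [← C_mul_X_pow_eq_monomial, evalEval_mul, evalEval_pow, evalEval_C, evalEval_X]
      exact (AnalyticOnNhd.eval_polynomial a).mul (analyticOnNhd_cexp.pow n)
  obtain ⟨z₀, hz₀⟩ := hT'.nonempty
  have hacc : ∃ᶠ z in 𝓝[≠] z₀, R.evalEval z (Complex.exp z) = 0 :=
    ((accPt_iff_frequently_nhdsNE.1 (hT.preperfect_of_nontrivial hT' z₀ hz₀))).mono h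
  have hall := han.eqOn_zero_of_preconnected_of_frequently_eq_zero isPreconnected_univ
    (Set.mem_univ z₀) hacc
  -- All the logarithms of `v` are zeros of the one-variable polynomial `R(·, v)`.
  have hR : ∀ v : ℂ, v ≠ 0 → R.IsRoot (C v) := by
    intro v hv
    refine eq_zero_of_infinite_isRoot _ (Set.Infinite.mono (s := Set.range fun n : ℕ =>
      Complex.log v + n * (2 * Real.pi * Complex.I)) ?_ ?_)
    · rintro _ ⟨n, rfl⟩
      have := hall (Set.mem_univ (Complex.log v + n * (2 * Real.pi * Complex.I)))
      have he : Complex.exp (Complex.log v + n * (2 * Real.pi * Complex.I)) = v := by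
        rw [Complex.exp_add, Complex.exp_log hv, Complex.exp_nat_mul_two_pi_mul_I, mul_one]
      simpa [he] using! this
    · refine Set.infinite_range_of_injective fun m n hmn => ?_
      simpa [Complex.I_ne_zero, Real.pi_ne_zero] using hmn
  refine eq_zero_of_infinite_isRoot _ (Set.Infinite.mono (s := C '' {v : ℂ | v ≠ 0}) ?_ ?_)
  · rintro _ ⟨v, hv, rfl⟩
    exact hR v hv
  · exact (Set.Infinite.image C_injective.injOn (Set.finite_singleton (0:ℂ)).infinite_compl)

/-! ### Polynomial functions on an algebraic graph -/

/-- The algebra of complex polynomial functions on the graph of `φ`, parametrized by the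
abscissa. -/
def graphAlgebra (φ : ℝ → ℝ) : Subalgebra ℂ (ℝ → ℂ) :=
  Algebra.adjoin ℂ {fun t : ℝ => (t : ℂ), fun t : ℝ => (φ t : ℂ)}

theorem abscissa_mem_graphAlgebra (φ : ℝ → ℝ) : (fun t : ℝ => (t : ℂ)) ∈ graphAlgebra φ :=
  Algebra.subset_adjoin (by simp)

theorem ordinate_mem_graphAlgebra (φ : ℝ → ℝ) : (fun t : ℝ => (φ t : ℂ)) ∈ graphAlgebra φ :=
  Algebra.subset_adjoin (by simp)

theorem evalEval_mem_graphAlgebra (φ : ℝ → ℝ) (Q : ℝ[X][Y]) :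
    (fun t : ℝ => ((Q.evalEval t (φ t) : ℝ) : ℂ)) ∈ graphAlgebra φ := by
  induction Q using Polynomial.induction_on' with
  | add p q hp hq =>
    simp only [evalEval_add, Complex.ofReal_add]
    exact (graphAlgebra φ).add_mem hp hq
  | monomial n a =>
    simp only [← C_mul_X_pow_eq_monomial, evalEval_mul, evalEval_pow, evalEval_C, evalEval_X,
      Complex.ofReal_mul, Complex.ofReal_pow]
    refine (graphAlgebra φ).mul_mem ?_ ((graphAlgebra φ).pow_mem (ordinate_mem_graphAlgebra φ) n)
    induction a using Polynomial.induction_on' with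
    | add p q hp hq =>
      simp only [eval_add, Complex.ofReal_add]
      exact (graphAlgebra φ).add_mem hp hq
    | monomial m c =>
      simp only [eval_monomial, Complex.ofReal_mul, Complex.ofReal_pow]
      exact (graphAlgebra φ).mul_mem ((graphAlgebra φ).algebraMap_mem (c : ℂ))
        ((graphAlgebra φ).pow_mem (abscissa_mem_graphAlgebra φ) m)

theorem analyticOnNhd_of_mem_graphAlgebra {J : Set ℝ} {φ : ℝ → ℝ} (hφ : AnalyticOnNhd ℝ φ J)
    {f : ℝ → ℂ} (hf : f ∈ graphAlgebra φ) : AnalyticOnNhd ℝ f J := by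
  induction hf using Algebra.adjoin_induction with
  | mem f hf =>
    rcases hf with rfl | rfl
    · exact fun t _ => Complex.ofRealCLM.analyticAt t
    · exact fun t ht => (Complex.ofRealCLM.analyticAt (φ t)).comp (hφ t ht)
  | algebraMap c => exact analyticOnNhd_const
  | add f g _ _ hf hg => exact hf.add hg
  | mul f g _ _ hf hg => exact hf.mul hg

theorem exists_hasDerivAt_evalEval (P : ℝ[X][Y]) :
    ∃ Q : ℝ[X][Y], ∀ (φ : ℝ → ℝ) (t d : ℝ), HasDerivAt φ d t →
      HasDerivAt (fun t => P.evalEval t (φ t))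
        (Q.evalEval t (φ t) + (derivative P).evalEval t (φ t) * d) t := by
  induction P using Polynomial.induction_on' with
  | add p q hp hq =>
    obtain ⟨Q₁, h₁⟩ := hp
    obtain ⟨Q₂, h₂⟩ := hq
    refine ⟨Q₁ + Q₂, fun φ t d hd => ?_⟩
    simp only [evalEval_add, derivative_add]
    convert! (h₁ φ t d hd).add (h₂ φ t d hd) using 1
    ring
  | monomial n a =>
    refine ⟨C (derivative a) * Y ^ n, fun φ t d hd => ?_⟩
    simp only [← C_mul_X_pow_eq_monomial, evalEval_mul, evalEval_pow, evalEval_C, evalEval_X,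
      derivative_C_mul, derivative_X_pow]
    convert! (a.hasDerivAt t).mul (hd.pow n) using 1
    simp
    ring

/-- Differentiating `P(t, φ t) = 0` gives `P_y φ' = -P_x`. Multiplying by `P_y` clears the
denominator of `φ'`, and the Leibniz rule extends this to the whole algebra. -/
theorem exists_mem_graphAlgebra_eq_mul_deriv {J : Set ℝ} (hJ : IsOpen J) {φ : ℝ → ℝ}
    (hφ : AnalyticOnNhd ℝ φ J) {P : ℝ[X][Y]} (hP : ∀ t ∈ J, P.evalEval t (φ t) = 0)
    {f : ℝ → ℂ} (hf : f ∈ graphAlgebra φ) : ∃ g ∈ graphAlgebra φ, ∀ t ∈ J,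
      g t = (((derivative P).evalEval t (φ t) : ℝ) : ℂ) * deriv f t := by
  have hδ := evalEval_mem_graphAlgebra φ (derivative P)
  induction hf using Algebra.adjoin_induction with
  | mem f hf =>
    rcases hf with rfl | rfl
    · refine ⟨_, hδ, fun t _ => ?_⟩
      have : HasDerivAt (fun t : ℝ => (t : ℂ)) 1 t := Complex.ofRealCLM.hasDerivAt
      rw [this.deriv, mul_one]
    · obtain ⟨Q, hQ⟩ := exists_hasDerivAt_evalEval P
      refine ⟨_, (graphAlgebra φ).neg_mem (evalEval_mem_graphAlgebra φ Q), fun t ht => ?_⟩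
      have hd := (hφ t ht).differentiableAt.hasDerivAt
      have h0 : (fun t => P.evalEval t (φ t)) =ᶠ[𝓝 t] fun _ => 0 := by
        filter_upwards [hJ.mem_nhds ht] with t' ht' using hP t' ht'
      have h1 := (hQ φ t _ hd).unique ((hasDerivAt_const t (0 : ℝ)).congr_of_eventuallyEq h0)
      rw [hd.ofReal_comp.deriv, Pi.neg_apply, ← Complex.ofReal_mul, ← Complex.ofReal_neg]
      congr 1
      linarith
  | algebraMap c =>
    refine ⟨0, (graphAlgebra φ).zero_mem, fun t _ => ?_⟩
    have : HasDerivAt (algebraMap ℂ (ℝ → ℂ) c) 0 t := hasDerivAt_const t c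
    rw [this.deriv, mul_zero, Pi.zero_apply]
  | add f g hf' hg' hf hg =>
    obtain ⟨a, ha, haf⟩ := hf
    obtain ⟨b, hb, hbg⟩ := hg
    refine ⟨a + b, (graphAlgebra φ).add_mem ha hb, fun t ht => ?_⟩
    have h1 := (analyticOnNhd_of_mem_graphAlgebra hφ hf' t ht).differentiableAt.hasDerivAt
    have h2 := (analyticOnNhd_of_mem_graphAlgebra hφ hg' t ht).differentiableAt.hasDerivAt
    rw [(h1.add h2).deriv, Pi.add_apply, haf t ht, hbg t ht, mul_add]
  | mul f g hf' hg' hf hg =>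
    obtain ⟨a, ha, haf⟩ := hf
    obtain ⟨b, hb, hbg⟩ := hg
    refine ⟨a * g + f * b, (graphAlgebra φ).add_mem ((graphAlgebra φ).mul_mem ha hg')
      ((graphAlgebra φ).mul_mem hf' hb), fun t ht => ?_⟩
    have h1 := (analyticOnNhd_of_mem_graphAlgebra hφ hf' t ht).differentiableAt.hasDerivAt
    have h2 := (analyticOnNhd_of_mem_graphAlgebra hφ hg' t ht).differentiableAt.hasDerivAt
    rw [(h1.mul h2).deriv, Pi.add_apply, Pi.mul_apply, Pi.mul_apply, haf t ht, hbg t ht]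
    ring

theorem restrictAnalytic_mem_adjoin {J : Set ℝ} {φ : ℝ → ℝ} (hφ : AnalyticOnNhd ℝ φ J)
    {f : ℝ → ℂ} (hf : f ∈ graphAlgebra φ) :
    restrictAnalytic f (analyticOnNhd_of_mem_graphAlgebra hφ hf) ∈ Algebra.adjoin ℂ
      {restrictAnalytic _ (analyticOnNhd_of_mem_graphAlgebra hφ (abscissa_mem_graphAlgebra φ)),
       restrictAnalytic _ (analyticOnNhd_of_mem_graphAlgebra hφ (ordinate_mem_graphAlgebra φ))} := by
  induction hf using Algebra.adjoin_induction with
  | mem f hf =>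
    rcases hf with rfl | rfl <;> exact Algebra.subset_adjoin (by simp)
  | algebraMap c => exact Subalgebra.algebraMap_mem _ c
  | add f g _ _ hf hg => exact Subalgebra.add_mem _ hf hg
  | mul f g _ _ hf hg => exact Subalgebra.mul_mem _ hf hg

/-- On the graph of an algebraic function, the exponential of a nonconstant polynomial function
is not a quotient of polynomial functions. -/
theorem not_mul_exp_mem_graphAlgebra {J : Set ℝ} (hJ : IsOpen J) (hJc : IsPreconnected J)
    {φ : ℝ → ℝ} (hφ : AnalyticOnNhd ℝ φ J) {P : ℝ[X][Y]} (hP0 : P ≠ 0)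
    (hP : ∀ t ∈ J, P.evalEval t (φ t) = 0) {β F G : ℝ → ℂ} (hβ : β ∈ graphAlgebra φ)
    (hβc : ∀ c, ∃ t ∈ J, β t ≠ c) (hF : F ∈ graphAlgebra φ) (hF0 : ¬ J.EqOn F 0)
    (hG : G ∈ graphAlgebra φ) : ¬ ∀ t ∈ J, F t * Complex.exp (β t) = G t := by
  intro hFG
  have hne : J.Nonempty := let ⟨t, ht, _⟩ := hβc 0; ⟨t, ht⟩
  have := isDomain_analyticSubalgebra hJc hne
  have han : ∀ f ∈ graphAlgebra φ, AnalyticOnNhd ℝ f J := fun f hf =>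
    analyticOnNhd_of_mem_graphAlgebra hφ hf
  set x := restrictAnalytic _ (han _ (abscissa_mem_graphAlgebra φ)) with hx
  set y := restrictAnalytic _ (han _ (ordinate_mem_graphAlgebra φ)) with hy
  have hJinf : J.Infinite := by
    obtain ⟨t, ht⟩ := hne
    exact infinite_of_mem_nhds t (hJ.mem_nhds ht)
  have hyx : IsAlgebraic (Algebra.adjoin ℂ {x}) y := by
    let ψ : ℝ[X] →+* Algebra.adjoin ℂ {x} :=
      eval₂RingHom ((algebraMap ℂ _).comp Complex.ofRealHom)
        ⟨x, Algebra.self_mem_adjoin_singleton ℂ x⟩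
    let ev : J → analyticSubalgebra J →+* ℂ := fun t =>
      (Pi.evalRingHom (fun _ : J => ℂ) t).comp (analyticSubalgebra J).val.toRingHom
    have hψ : ∀ t : J, ((ev t).comp (algebraMap (Algebra.adjoin ℂ {x}) _)).comp ψ =
        Complex.ofRealHom.comp (evalRingHom (t : ℝ)) := by
      intro t
      ext
      · simp [ψ, ev]
      · simp [ψ, ev]
        rfl
    refine ⟨P.map ψ, ?_, ?_⟩
    -- `J` is infinite, so no nonzero polynomial in the abscissa vanishes on it and `P` stays
    -- nonzero.
    · refine (Polynomial.map_ne_zero_iff ((injective_iff_map_eq_zero ψ).2 fun p hp => ?_)).2 hP0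
      refine eq_zero_of_infinite_isRoot p (hJinf.mono fun t ht => ?_)
      have := congrArg (fun f => f p) (hψ ⟨t, ht⟩)
      simp only [RingHom.comp_apply, hp, map_zero] at this
      simpa using! this.symm
    · refine Subtype.ext (funext fun t => ?_)
      have h1 : ev t (aeval y (P.map ψ)) =
          eval₂ (((ev t).comp (algebraMap (Algebra.adjoin ℂ {x}) _)).comp ψ) (ev t y) P := by
        rw [aeval_def, hom_eval₂, eval₂_map]
      have h2 : ev t y = Complex.ofRealHom (φ t) := rfl
      rw [hψ, h2, ← hom_eval₂, eval₂_evalRingHom, hP t t.2, map_zero] at h1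
      exact h1
  have hw : AnalyticOnNhd ℝ (fun t => Complex.exp (β t)) J := fun t ht =>
    (analyticAt_cexp.restrictScalars (𝕜 := ℝ)).comp (han _ hβ t ht)
  have halg := isAlgebraic_adjoin_singleton_of_transcendental (w := restrictAnalytic _ hw) hyx
    (restrictAnalytic_mem_adjoin hφ hβ)
    (transcendental_of_not_mem_range fun c hc => by
      obtain ⟨t, ht, hne⟩ := hβc c
      exact hne (congrFun (congrArg Subtype.val hc) ⟨t, ht⟩).symm)
    (restrictAnalytic_mem_adjoin hφ hF)
    (fun h0 => hF0 fun t ht => congrFun (congrArg Subtype.val h0) ⟨t, ht⟩)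
    (by
      convert restrictAnalytic_mem_adjoin hφ hG using 1
      exact Subtype.ext (funext fun t => hFG t t.2))
  obtain ⟨R, hR0, hR⟩ := exists_bivariate_of_isAlgebraic_adjoin halg
  refine hR0 (eq_zero_of_evalEval_exp_eq_zero (T := β '' J)
    (hJc.image β (han β hβ).continuousOn) ?_ ?_)
  · obtain ⟨t₀, ht₀⟩ := hne
    obtain ⟨t, ht, hne⟩ := hβc (β t₀)
    exact ⟨β t, ⟨t, ht, rfl⟩, β t₀, ⟨t₀, ht₀, rfl⟩, hne⟩
  · rintro _ ⟨t, ht, rfl⟩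
    let ev : analyticSubalgebra J →ₐ[ℂ] ℂ :=
      (Pi.evalAlgHom ℂ (fun _ : J => ℂ) ⟨t, ht⟩).comp (analyticSubalgebra J).val
    have hcomp : ev.comp (aevalAeval (restrictAnalytic β (han β hβ)) (restrictAnalytic _ hw)) =
        aevalAeval (β t) (Complex.exp (β t)) := by
      ext <;> simp [ev] <;> rfl
    rw [← coe_aevalAeval_eq_evalEval, ← hcomp, AlgHom.comp_apply, hR, map_zero]

/-! ### Pulling back equations along `E` -/

theorem cexp_eq (v : Fin 2 → ℝ) : cexp v = (E v).1 0 + Complex.I * (E v).1 1 := by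
  rw [mul_comm]
  exact (Complex.re_add_im (cexp v)).symm

/-- A nonzero element of the ideal of `W`, multiplied by a power of the unit `normPoly`, becomes a
nonzero polynomial. -/
theorem IsWeaklyBialgebraic.exists_eval_E_eq_zero {S : Set (Fin 2 → ℝ)}
    (hS : IsWeaklyBialgebraic S) :
    ∃ Q : PlaneRing, Q ≠ 0 ∧ ∀ v ∈ S, MvPolynomial.eval (E v).1 Q = 0 := by
  obtain ⟨J, hJ, hSJ⟩ := hS.image_subset
  obtain ⟨f, hfJ, hf0⟩ := (Submodule.ne_bot_iff J).1 hJ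
  obtain ⟨n, Q, hQ⟩ := IsLocalization.Away.surj normPoly f
  have heval : ∀ p (q : PlaneRing), GRing.eval p (algebraMap PlaneRing GRing q) =
      MvPolynomial.eval p.1 q := fun p q =>
    IsLocalization.Away.lift_eq normPoly (isUnit_eval_normPoly p) q
  refine ⟨Q, ?_, fun v hv => ?_⟩
  · rintro rfl
    rw [map_zero] at hQ
    refine hf0 ((IsUnit.mul_left_eq_zero ?_).1 hQ)
    exact (IsLocalization.Away.algebraMap_isUnit normPoly).pow n
  · rw [← heval, ← hQ, map_mul, hSJ ⟨v, hv, rfl⟩ f hfJ, zero_mul]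

/-- A polynomial in the coordinates of `E v`, written as a polynomial in `cexp v` and its
conjugate. -/
theorem exists_eval_cexp_conj (Q : PlaneRing) (hQ : Q ≠ 0) :
    ∃ R : MvPolynomial (Fin 2) ℂ, R ≠ 0 ∧ ∀ v,
      MvPolynomial.eval ![cexp v, (starRingEnd ℂ) (cexp v)] R =
        (MvPolynomial.eval (E v).1 Q : ℝ) := by
  let φ : PlaneRing →ₐ[ℝ] MvPolynomial (Fin 2) ℂ := MvPolynomial.aeval
    ![.C (1 / 2) * (.X 0 + .X 1), .C (-Complex.I / 2) * (.X 0 - .X 1)]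
  let ψ : MvPolynomial (Fin 2) ℂ →ₐ[ℂ] MvPolynomial (Fin 2) ℂ := MvPolynomial.aeval
    ![.X 0 + .C Complex.I * .X 1, .X 0 - .C Complex.I * .X 1]
  refine ⟨φ Q, fun h0 => hQ ?_, fun v => ?_⟩
  -- `ψ` undoes the substitution `φ`, so `φ` cannot kill `Q`.
  · have hcomp : (ψ : MvPolynomial (Fin 2) ℂ →+* _).comp (φ : PlaneRing →+* _) =
        MvPolynomial.map Complex.ofRealHom := by
      refine MvPolynomial.ringHom_ext (fun r => ?_) (fun i => ?_)
      · simp [φ, ψ, MvPolynomial.algebraMap_apply]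
      · have h2 : (MvPolynomial.C (1 / 2) * 2 : MvPolynomial (Fin 2) ℂ) = 1 := by
          rw [← map_ofNat MvPolynomial.C 2, ← map_mul]
          norm_num
        have hI : (MvPolynomial.C (-Complex.I / 2) * (2 * MvPolynomial.C Complex.I) :
            MvPolynomial (Fin 2) ℂ) = 1 := by
          rw [← map_ofNat MvPolynomial.C 2, ← map_mul, ← map_mul]
          rw [← MvPolynomial.C_1]
          congr 1
          linear_combination -Complex.I_sq
        fin_cases i
        · simp only [φ, ψ, RingHom.comp_apply, RingHom.coe_coe, MvPolynomial.aeval_X,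
            MvPolynomial.map_X]
          simp only [Fin.zero_eta, Matrix.cons_val_zero, map_mul, map_add, MvPolynomial.algHom_C,
            MvPolynomial.aeval_X, Matrix.cons_val_one, MvPolynomial.algebraMap_eq]
          linear_combination MvPolynomial.X 0 * h2
        · simp only [φ, ψ, RingHom.comp_apply, RingHom.coe_coe, MvPolynomial.aeval_X,
            MvPolynomial.map_X]
          simp only [Fin.mk_one, Matrix.cons_val_zero, map_mul, map_sub, MvPolynomial.algHom_C,
            MvPolynomial.aeval_X, Matrix.cons_val_one, MvPolynomial.algebraMap_eq]
          linear_combination MvPolynomial.X 1 * hI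
    refine MvPolynomial.map_injective Complex.ofRealHom Complex.ofReal_injective ?_
    rw [map_zero, ← hcomp]
    simp [h0]
  · have hcomp : (MvPolynomial.eval ![cexp v, (starRingEnd ℂ) (cexp v)]).comp
        (φ : PlaneRing →+* _) = Complex.ofRealHom.comp (MvPolynomial.eval (E v).1) := by
      refine MvPolynomial.ringHom_ext (fun r => ?_) (fun i => ?_)
      · simp [φ, MvPolynomial.algebraMap_apply]
      · fin_cases i
        · simp [φ, cexp_eq]
          ring
        · simp [φ, cexp_eq]
          ring_nf
          simp
    exact congrArg (fun f => f Q) hcomp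

theorem cexp_pow_mul_conj_pow (v : Fin 2 → ℝ) (m n : ℕ) :
    cexp v ^ m * (starRingEnd ℂ) (cexp v) ^ n = Complex.exp (2 * Real.pi * Complex.I *
      (((m : ℂ) - n) * (v 0 : ℂ) + Complex.I * ((m + n) * (v 1 : ℂ)))) := by
  rw [cexp, ← Complex.exp_conj, ← Complex.exp_nat_mul, ← Complex.exp_nat_mul, ← Complex.exp_add]
  congr 1
  simp only [map_mul, map_add, Complex.conj_I, Complex.conj_ofReal, map_ofNat (starRingEnd ℂ) 2]
  ring

/-- An algebraic function whose graph is mapped by `E` into a proper algebraic subset of the plane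
is constant. -/
theorem exists_eq_const_of_eval_E_eq_zero {J : Set ℝ} (hJ : IsOpen J) (hJc : IsPreconnected J)
    {φ : ℝ → ℝ} (hφ : AnalyticOnNhd ℝ φ J) {P : ℝ[X][Y]} (hP0 : P ≠ 0)
    (hP : ∀ t ∈ J, P.evalEval t (φ t) = 0) (hP' : ∀ t ∈ J, (derivative P).evalEval t (φ t) ≠ 0)
    {Q : PlaneRing} (hQ0 : Q ≠ 0) (hQ : ∀ t ∈ J, MvPolynomial.eval (E ![t, φ t]).1 Q = 0) :
    ∃ c, ∀ t ∈ J, φ t = c := by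
  obtain rfl | hne := J.eq_empty_or_nonempty
  · exact ⟨0, fun t ht => absurd ht (Set.notMem_empty t)⟩
  obtain ⟨R, hR0, hR⟩ := exists_eval_cexp_conj Q hQ0
  set B := graphAlgebra φ with hB
  let α : (Fin 2 →₀ ℕ) → ℝ → ℂ := fun m t => 2 * Real.pi * Complex.I *
    (((m 0 : ℂ) - m 1) * (t : ℂ) + Complex.I * ((m 0 + m 1) * (φ t : ℂ)))
  have hα : ∀ m, α m ∈ B := fun m =>
    B.mul_mem (B.algebraMap_mem (2 * Real.pi * Complex.I)) (B.add_mem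
      (B.mul_mem (B.algebraMap_mem ((m 0 : ℂ) - m 1)) (abscissa_mem_graphAlgebra φ))
      (B.mul_mem (B.algebraMap_mem Complex.I)
        (B.mul_mem (B.algebraMap_mem ((m 0 : ℂ) + m 1)) (ordinate_mem_graphAlgebra φ))))
  obtain ⟨i, -, j, -, hij, F, hF, G, hG, hF0, hFG⟩ := exists_exp_eq_of_sum_mul_exp_eq_zero hJ hJc
    (B := B) (fun f hf => analyticOnNhd_of_mem_graphAlgebra hφ hf)
    (δ := fun t => (((derivative P).evalEval t (φ t) : ℝ) : ℂ))
    (fun t ht => Complex.ofReal_ne_zero.2 (hP' t ht))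
    (fun f hf => exists_mem_graphAlgebra_eq_mul_deriv hJ hφ hP hf)
    R.support (fun m _ => R.coeff m) α (fun m _ => B.algebraMap_mem (R.coeff m))
    (fun m _ => hα m)
    (fun m hm h0 => MvPolynomial.mem_support_iff.1 hm (h0 hne.some_mem))
    (Finset.nonempty_iff_ne_empty.2 fun h => hR0 (MvPolynomial.support_eq_empty.1 h))
    (fun t ht => by
      have h1 := hR ![t, φ t]
      rw [hQ t ht, MvPolynomial.eval_eq', Complex.ofReal_zero] at h1
      rw [← h1]
      refine Finset.sum_congr rfl fun m _ => ?_
      congr 1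
      simpa using (cexp_pow_mul_conj_pow ![t, φ t] (m 0) (m 1)).symm)
  have hconst : ∃ c, ∀ t ∈ J, α i t - α j t = c := by
    by_contra! hcon
    refine not_mul_exp_mem_graphAlgebra hJ hJc hφ hP0 hP (B.sub_mem (hα i) (hα j)) hcon hF hF0 hG
      fun t ht => ?_
    rw [Pi.sub_apply, Complex.exp_sub, ← mul_div_assoc, hFG t ht,
      mul_div_cancel_right₀ _ (Complex.exp_ne_zero _)]
  obtain ⟨c, hc⟩ := hconst
  set a : ℝ := ((i 0 : ℝ) - i 1) - (j 0 - j 1) with ha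
  set b : ℝ := ((i 0 : ℝ) + i 1) - (j 0 + j 1) with hb
  -- The constant exponent is `2πi (a t + i b φ t)`. As `a`, `b`, `t`, `φ t` are real, both `a t`
  -- and `b φ t` are constant.
  have hab : ∀ t ∈ J, a * t = (c / (2 * Real.pi * Complex.I)).re ∧
      b * φ t = (c / (2 * Real.pi * Complex.I)).im := by
    intro t ht
    have : c / (2 * Real.pi * Complex.I) = (a * t : ℝ) + (b * φ t : ℝ) * Complex.I := by
      rw [div_eq_iff Complex.two_pi_I_ne_zero, ← hc t ht]
      simp only [α, ha, hb]
      push_cast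
      ring
    rw [this]
    simp
  obtain ⟨t₀, ht₀⟩ := hne
  have ha0 : a = 0 := by
    obtain ⟨t, ht, htt⟩ := (infinite_of_mem_nhds t₀ (hJ.mem_nhds ht₀) : J.Infinite).nontrivial.exists_ne t₀
    have h := (hab t ht).1.trans (hab t₀ ht₀).1.symm
    by_contra hne
    exact htt (mul_left_cancel₀ hne h)
  -- With `a = 0`, also `b = 0` would make the two multi-indices equal.
  have hb0 : b ≠ 0 := by
    intro hb0
    refine hij (Finsupp.ext fun k => ?_)
    have h0 : (i 0 : ℝ) = j 0 := by linarith
    have h1 : (i 1 : ℝ) = j 1 := by linarith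
    fin_cases k
    · exact_mod_cast h0
    · exact_mod_cast h1
  exact ⟨φ t₀, fun t ht => mul_left_cancel₀ hb0 ((hab t ht).2.trans (hab t₀ ht₀).2.symm)⟩

end RealExp

/-! ### The classification -/

theorem mainTheorem3 (S : Set (Fin 2 → ℝ)) (hS : RealExp.IsWeaklyBialgebraic S)
    (hne : S.Nonempty) (hpt : ∀ p : Fin 2 → ℝ, S ≠ {p}) :
    (∃ t : ℝ, S = RealExp.horizontalLine t) ∨ (∃ t : ℝ, S = RealExp.verticalLine t) := by
  open Polynomial Bivariate Filter Topology RealExp in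
  by_cases hx : ∀ p : ℝ[X], p ≠ 0 → ¬ VanishesOn S (C p)
  · left
    obtain ⟨P, x₀, φ, hPS, hP0, hmin, hφ, hev⟩ := hS.exists_arc hx
    obtain ⟨Q, hQ0, hQ⟩ := hS.exists_eval_E_eq_zero
    obtain ⟨ε, hε, hball⟩ :=
      Metric.eventually_nhds_iff_ball.1 (hφ.eventually_analyticAt.and hev)
    obtain ⟨c, hc⟩ := exists_eq_const_of_eval_E_eq_zero Metric.isOpen_ball
      (convex_ball x₀ ε).isPreconnected (fun t ht => (hball t ht).1) hP0
      (fun t ht => by simpa using hPS _ (hball t ht).2.1) (fun t ht => (hball t ht).2.2)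
      hQ0 (fun t ht => hQ _ (hball t ht).2.1)
    have hseg : ∀ᶠ x in 𝓝 x₀, ![x, c] ∈ S := by
      filter_upwards [Metric.ball_mem_nhds x₀ hε] with x hx
      rw [← hc x hx]
      exact (hball x hx).2.1
    have hY := hS.vanishesOn_of_segment hPS hP0 hmin hseg
    refine ⟨c, hS.eq_horizontalLine hne hpt fun v hv => ?_⟩
    have := hY v hv
    rwa [evalEval_sub, evalEval_X, evalEval_C, eval_C, sub_eq_zero] at this
  · right
    push Not at hx
    obtain ⟨p, hp0, hp⟩ := hx
    obtain ⟨t, ht⟩ := hS.exists_eq_of_eval_eq_zero hne (C X) hp0 (fun v hv => by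
      simpa [evalEval_C] using hp v hv)
    exact ⟨t, hS.eq_verticalLine hne hpt fun v hv => by simpa [evalEval_C] using ht v hv⟩
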